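/- Let $\mathcal P=(\mathcal P,\{-\},\bigcup)$ be the power set monad on the category $\mathbf{Set}$ and let $\mathbb S=\{0,1\}$ be the Sierpinski space, with open sets $\emptyset,\{1\},\{0,1\}$. Let $U_{\mathcal P}\colon \mathbf{Kl}(\mathcal P)\to\mathbf{Top}$ be the functor sending a set $X$ to the product space $\mathbb S^X$ (whose points are identified with the subsets of $X$) and a Kleisli morphism $f\colon X\to\mathcal P Y$ to the continuous map $\mathbb S^X\to\mathbb S^Y$, $A\mapsto\bigcup_{x\in A}f(x)$. Let $\mathbb V_\downarrow$ be the lower Vietoris monad (Hoare hyperspace monad) on $\mathbf{Top}$: the space $\mathbb V_\downarrow X$ consists of all closed subsets of $X$, with the topology generated by the sets $\Diamond U=\{C : C\cap U\neq\emptyset\}$ for $U\subseteq X$ open; a continuous map $f\colon X\to Y$ acts by $C\mapsto\overline{f[C]}$; the unit is $x\mapsto\overline{\{x\}}$ and the multiplication is $\mathcal C\mapsto\overline{\bigcup\mathcal C}$. The codensity monad of a functor $F$ is the right Kan extension $\mathrm{Ran}_F F$ with unit and multiplication induced by its universal property. **Theorem.** 1. The right Kan extension of $U_{\mathcal P}$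 along itself exists and is pointwise (for each space $X$ the limit $\lim_{f\colon X\to U_{\mathcal P}A}U_{\mathcal P}A$ exists in $\mathbf{Top}$), and $\mathbb V_\downarrow$ is isomorphic, as a monad, to the codensity monad of $U_{\mathcal P}$. 2. Let $\mathbf{CJSL}$ be the category of complete join-semilattices and maps preserving all joins. Let $\mathbf{Top}(-,\mathbb S)\dashv\mathbf{CJSL}(-,2)\colon\mathbf{CJSL}^{\mathrm{op}}\to\mathbf{Top}$ be the dual adjunction in which $\mathbf{Top}(X,\mathbb S)$ is the lattice of open subsets of $X$ and $\mathbf{CJSL}(J,2)$ is topologized as a subspace of $\mathbb S^{J}$. The maps $\mathbb V_\downarrow X\to\mathbf{CJSL}(\mathbf{Top}(X,\mathbb S),2)$ sending a closed set $C$ to the morphism $\chi_C$ with $\chi_C(U)=1$ iff $C\cap U\neq\emptyset$ form an isomorphism of monads from $\mathbb V_\downarrow$ to the monad induced by this adjunction. -/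

import Mathlib

open CategoryTheory TopologicalSpace Opposite

universe w v' v u

/-! ### The codensity monad of a functor -/

section Codensity

variable {A : Type w} {C : Type u} [Category.{v} C]

/-- The codensity monad `(Ran_F F, η, μ)` of a functor `F : A ⥤ C` whose right Kan extension along
itself exists. With `φ : F ⋙ Ran_F F ⟶ F` the counit, `η` is the transformation corresponding to
`𝟙 : F ⟶ F`, and `μ` the one corresponding to
`(Ran_F F) (Ran_F F) F ⟶ (Ran_F F) F ⟶ F`, the composite of `(Ran_F F) φ` and `φ`. -/
noncomputable def codensityMonad [Category.{v'} A] (F : A ⥤ C) [F.HasRightKanExtension F] :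
    Monad C where
  toFunctor := F.rightKanExtension F
  η := (F.rightKanExtension F).liftOfIsRightKanExtension (F.rightKanExtensionCounit F)
    (𝟭 C) F.rightUnitor.hom
  μ := (F.rightKanExtension F).liftOfIsRightKanExtension (F.rightKanExtensionCounit F)
    (F.rightKanExtension F ⋙ F.rightKanExtension F)
    ((Functor.associator F (F.rightKanExtension F) (F.rightKanExtension F)).inv ≫
      Functor.whiskerRight (F.rightKanExtensionCounit F) (F.rightKanExtension F) ≫
      F.rightKanExtensionCounit F)
  assoc := by
    set T := F.rightKanExtension F
    set φ := F.rightKanExtensionCounit F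
    set m := T.liftOfIsRightKanExtension φ (T ⋙ T) ((Functor.associator F T T).inv ≫
      Functor.whiskerRight φ T ≫ φ) with hm
    have key (X : A) : m.app (F.obj X) ≫ φ.app X = T.map (φ.app X) ≫ φ.app X := by
      simp [hm]
    have h : Functor.whiskerRight m T ≫ m =
        (Functor.associator T T T).hom ≫ Functor.whiskerLeft T m ≫ m := by
      apply T.hom_ext_of_isRightKanExtension φ
      ext X
      simp only [NatTrans.comp_app, Functor.whiskerLeft_app, Functor.whiskerRight_app,
        Functor.associator_hom_app, Category.assoc, key, Category.id_comp]
      rw [← T.map_comp_assoc, key, T.map_comp_assoc]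
      refine Eq.trans ?_ (m.naturality_assoc (φ.app X) (φ.app X))
      rw [key]
      rfl
    intro X
    simpa using NatTrans.congr_app h X
  left_unit := by
    set T := F.rightKanExtension F
    set φ := F.rightKanExtensionCounit F
    set m := T.liftOfIsRightKanExtension φ (T ⋙ T) ((Functor.associator F T T).inv ≫
      Functor.whiskerRight φ T ≫ φ) with hm
    set e := T.liftOfIsRightKanExtension φ (𝟭 C) F.rightUnitor.hom with he
    have key (X : A) : m.app (F.obj X) ≫ φ.app X = T.map (φ.app X) ≫ φ.app X := by
      simp [hm]
    have key' (X : A) : e.app (F.obj X) ≫ φ.app X = 𝟙 _ := by simp [he]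
    have h : T.rightUnitor.inv ≫ (Functor.whiskerLeft T e) ≫ m = 𝟙 T := by
      apply T.hom_ext_of_isRightKanExtension φ
      ext X
      simp only [NatTrans.comp_app, Functor.whiskerLeft_app,
        Functor.rightUnitor_inv_app, Category.assoc, key, Category.id_comp]
      refine (e.naturality_assoc (φ.app X) (φ.app X)).symm.trans ?_
      rw [key']
      simp
    intro X
    simpa using NatTrans.congr_app h X
  right_unit := by
    set T := F.rightKanExtension F
    set φ := F.rightKanExtensionCounit F
    set m := T.liftOfIsRightKanExtension φ (T ⋙ T) ((Functor.associator F T T).inv ≫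
      Functor.whiskerRight φ T ≫ φ) with hm
    set e := T.liftOfIsRightKanExtension φ (𝟭 C) F.rightUnitor.hom with he
    have key (X : A) : m.app (F.obj X) ≫ φ.app X = T.map (φ.app X) ≫ φ.app X := by
      simp [hm]
    have key' (X : A) : e.app (F.obj X) ≫ φ.app X = 𝟙 _ := by simp [he]
    have h : T.leftUnitor.inv ≫ (Functor.whiskerRight e T) ≫ m = 𝟙 T := by
      apply T.hom_ext_of_isRightKanExtension φ
      ext X
      simp only [NatTrans.comp_app, Functor.whiskerLeft_app, Functor.whiskerRight_app,
        Functor.leftUnitor_inv_app, Category.assoc, key, Category.id_comp]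
      rw [← T.map_comp_assoc, key']
      simp
    intro X
    simpa using NatTrans.congr_app h X

end Codensity

/-! ### The power set monad and the functor `U_P : Kl(P) ⥤ Top` -/

/-- The power set monad `P` on the category of sets: `P X` is the set of subsets of `X`, functions
act by direct image, the unit is `x ↦ {x}`, the multiplication is union. -/
def powersetMonad : Monad (Type u) where
  obj X := Set X
  map f := ↾(fun S => f '' S)
  map_id X := TypeCat.Hom.ext <| TypeCat.Fun.ext <| funext fun S : Set X => Set.image_id S
  map_comp f g := TypeCat.Hom.ext <| TypeCat.Fun.ext <| funext fun S =>
    Set.image_comp g f S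
  η :=
    { app X := ↾(fun x => ({x} : Set X))
      naturality X Y f := TypeCat.Hom.ext <| TypeCat.Fun.ext <| funext fun x =>
        (Set.image_singleton (f := f) (a := x)).symm }
  μ :=
    { app X := ↾(fun S : Set (Set X) => ⋃₀ S)
      naturality X Y f := TypeCat.Hom.ext <| TypeCat.Fun.ext <| funext fun S =>
        (Set.image_sUnion (f := f) (s := S)).symm }
  assoc X := TypeCat.Hom.ext <| TypeCat.Fun.ext <| funext fun (S : Set (Set (Set X))) => by
    change ⋃₀ ((fun T => ⋃₀ T) '' S) = ⋃₀ ⋃₀ S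
    ext x
    simp only [Set.mem_sUnion, Set.mem_image]
    grind
  left_unit X := TypeCat.Hom.ext <| TypeCat.Fun.ext <| funext fun (S : Set X) =>
    Set.sUnion_singleton S
  right_unit X := TypeCat.Hom.ext <| TypeCat.Fun.ext <| funext fun (S : Set X) =>
    (Set.sUnion_image _ _).trans (Set.biUnion_of_singleton S)

/-- The map `𝕊 ^ X → 𝕊 ^ Y` induced by `f : X → P Y`. With subsets identified with their indicator
functions, it is `A ↦ ⋃ x ∈ A, f x`. Here the Sierpinski space `𝕊` is `Prop` with `{True}` open. -/
def sierpinskiPowerMap {X Y : Type u} (f : X → Set Y) : C(X → Prop, Y → Prop) where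
  toFun A y := ∃ x, A x ∧ y ∈ f x
  continuous_toFun := by
    refine continuous_pi fun y => continuous_Prop.2 ?_
    have : {A : X → Prop | ∃ x, A x ∧ y ∈ f x} = ⋃ x ∈ {x : X | y ∈ f x}, {A | A x} := by
      ext A
      simp [and_comm]
    rw [this]
    exact isOpen_biUnion fun x _ => continuous_Prop.1 (continuous_apply x)

/-- The forgetful functor `U_P : Kl(P) ⥤ Top` of the Kleisli category of the power set monad. It
sends `X` to the power `𝕊 ^ X` of the Sierpinski space, a subset of `X` being identified with its
indicator function, and it acts on Kleisli morphisms as the canonical functor `Kl(P) ⥤ Set`. -/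
def powersetKleisliToTop : Kleisli powersetMonad.{u} ⥤ TopCat.{u} where
  obj X := TopCat.of (X.of → Prop)
  map {X Y} f := TopCat.ofHom (sierpinskiPowerMap (fun x => (show Set Y.of from f.of x)))
  map_id _ := TopCat.hom_ext <| ContinuousMap.ext fun _ => funext fun y => propext
    ⟨fun ⟨x, hx, hy⟩ => (show y = x from hy) ▸ hx, fun hy => ⟨y, hy, rfl⟩⟩
  map_comp _ _ := TopCat.hom_ext <| ContinuousMap.ext fun _ => funext fun _ => propext
    ⟨fun ⟨x, hx, _, ⟨y, hy, rfl⟩, hz⟩ => ⟨y, ⟨x, hx, hy⟩, hz⟩,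
      fun ⟨y, ⟨x, hx, hy⟩, hz⟩ => ⟨x, hx, _, ⟨y, hy, rfl⟩, hz⟩⟩

/-- `U_P` acts on Kleisli morphisms as the canonical functor `Kl(P) ⥤ Set`, `f ↦ μ ∘ P f`. -/
theorem powersetKleisliToTop_map {X Y : Kleisli powersetMonad.{u}} (f : X ⟶ Y) (S : Set X.of) :
    {y : Y.of | (show Y.of → Prop from powersetKleisliToTop.map f (fun x : X.of => x ∈ S)) y} =
      (Kleisli.Adjunction.fromKleisli powersetMonad.{u}).map f S := by
  refine Set.ext fun y => ⟨?_, ?_⟩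
  · rintro ⟨x, hx, hy⟩
    exact ⟨_, ⟨x, hx, rfl⟩, hy⟩
  · rintro ⟨_, ⟨x, hx, rfl⟩, hy⟩
    exact ⟨x, hx, hy⟩

/-! ### The lower Vietoris monad -/

section LowerVietoris

/-- The lower Vietoris topology on the set of closed subsets of `X`: it is generated by the sets
`◇U = {C | C ∩ U ≠ ∅}` for `U ⊆ X` open. -/
@[reducible] def lowerVietorisTopology (X : Type u) [TopologicalSpace X] :
    TopologicalSpace (Closeds X) :=
  .generateFrom {S | ∃ U : Set X, IsOpen U ∧ S = {C : Closeds X | ((C : Set X) ∩ U).Nonempty}}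

attribute [local instance] lowerVietorisTopology

theorem isOpen_hit {X : Type u} [TopologicalSpace X] {U : Set X} (hU : IsOpen U) :
    IsOpen {C : Closeds X | ((C : Set X) ∩ U).Nonempty} :=
  isOpen_generateFrom_of_mem ⟨U, hU, rfl⟩

theorem continuous_of_hit {X Z : Type u} [TopologicalSpace X] [TopologicalSpace Z]
    {g : Z → Closeds X}
    (h : ∀ U : Set X, IsOpen U → IsOpen {z | ((g z : Set X) ∩ U).Nonempty}) : Continuous g :=
  continuous_generateFrom_iff.2 (by rintro _ ⟨U, hU, rfl⟩; exact h U hU)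

theorem closeds_ext_of_hit {X : Type u} [TopologicalSpace X] {C D : Closeds X}
    (h : ∀ U : Set X, IsOpen U → (((C : Set X) ∩ U).Nonempty ↔ ((D : Set X) ∩ U).Nonempty)) :
    C = D := by
  have key : ∀ E F : Closeds X,
      (∀ U : Set X, IsOpen U → ((E : Set X) ∩ U).Nonempty → ((F : Set X) ∩ U).Nonempty) →
      (E : Set X) ⊆ F := by
    intro E F h x hx
    by_contra hF
    obtain ⟨y, hy, hy'⟩ := h (F : Set X)ᶜ F.isClosed.isOpen_compl ⟨x, hx, hF⟩
    exact hy' hy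
  exact Closeds.ext (Set.Subset.antisymm (key C D fun U hU => (h U hU).1)
    (key D C fun U hU => (h U hU).2))

theorem hit_image {X Y : Type u} [TopologicalSpace X] [TopologicalSpace Y] (f : X → Y)
    (C : Set X) {U : Set Y} (hU : IsOpen U) :
    ((Closeds.closure (f '' C) : Set Y) ∩ U).Nonempty ↔ (C ∩ f ⁻¹' U).Nonempty := by
  rw [Closeds.coe_closure, closure_inter_open_nonempty_iff hU, Set.image_inter_nonempty_iff]

theorem hit_singleton {X : Type u} [TopologicalSpace X] (x : X) {U : Set X} (hU : IsOpen U) :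
    ((Closeds.closure {x} : Set X) ∩ U).Nonempty ↔ x ∈ U := by
  rw [Closeds.coe_closure, closure_inter_open_nonempty_iff hU, Set.singleton_inter_nonempty]

theorem hit_biUnion {X : Type u} [TopologicalSpace X] (S : Set (Closeds X)) {U : Set X}
    (hU : IsOpen U) :
    ((Closeds.closure (⋃ C ∈ S, (C : Set X)) : Set X) ∩ U).Nonempty ↔
      (S ∩ {C : Closeds X | ((C : Set X) ∩ U).Nonempty}).Nonempty := by
  rw [Closeds.coe_closure, closure_inter_open_nonempty_iff hU]
  constructor
  · rintro ⟨x, hx, hxU⟩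
    simp only [Set.mem_iUnion] at hx
    obtain ⟨C, hC, hx⟩ := hx
    exact ⟨C, hC, x, hx, hxU⟩
  · rintro ⟨C, hC, x, hx, hxU⟩
    exact ⟨x, Set.mem_biUnion hC hx, hxU⟩

/-- The lower Vietoris monad (Hoare hyperspace monad) on `Top`. It sends `X` to the space of its
closed subsets with the lower Vietoris topology, and a continuous map `f` to `C ↦ closure (f '' C)`.
The unit is `x ↦ closure {x}`, and the multiplication is `𝒞 ↦ closure (⋃ C ∈ 𝒞, C)`. -/
def lowerVietorisMonad : Monad TopCat.{u} where
  obj X := TopCat.of (Closeds X)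
  map {X Y} f := TopCat.ofHom
    { toFun := fun C => Closeds.closure (f '' (C : Set X))
      continuous_toFun := continuous_of_hit fun U hU => by
        simp only [hit_image _ _ hU]
        exact isOpen_hit (hU.preimage f.hom.continuous) }
  map_id X := TopCat.hom_ext <| ContinuousMap.ext fun C => closeds_ext_of_hit fun U hU =>
    hit_image _ _ hU
  map_comp {X Y Z} f g := TopCat.hom_ext <| ContinuousMap.ext fun C =>
    closeds_ext_of_hit fun U hU => (hit_image _ _ hU).trans <| Iff.symm <|
      (hit_image g _ hU).trans (hit_image f _ (hU.preimage g.hom.continuous))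
  η :=
    { app X := TopCat.ofHom
        { toFun := fun x => Closeds.closure ({x} : Set X)
          continuous_toFun := continuous_of_hit fun U hU => by
            simp only [hit_singleton _ hU]
            exact hU }
      naturality X Y f := TopCat.hom_ext <| ContinuousMap.ext fun x =>
        closeds_ext_of_hit fun U hU => (hit_singleton (f x) hU).trans <| Iff.symm <|
          (hit_image f _ hU).trans (hit_singleton x (hU.preimage f.hom.continuous)) }
  μ :=
    { app X := TopCat.ofHom
        { toFun := fun (𝒞 : Closeds (Closeds X)) =>
            Closeds.closure (⋃ C ∈ (𝒞 : Set (Closeds X)), (C : Set X))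
          continuous_toFun := continuous_of_hit fun U hU => by
            simp only [hit_biUnion _ hU]
            exact isOpen_hit (isOpen_hit hU) }
      naturality X Y f := TopCat.hom_ext <| ContinuousMap.ext fun 𝒞 =>
        closeds_ext_of_hit fun U hU => by
          refine (hit_biUnion _ hU).trans ((hit_image _ _ (isOpen_hit hU)).trans ?_)
          refine Iff.trans ?_ ((hit_image f _ hU).trans
            (hit_biUnion _ (hU.preimage f.hom.continuous))).symm
          exact iff_of_eq (congrArg (fun S => Set.Nonempty (_ ∩ S))
            (Set.ext fun C => hit_image f (C : Set X) hU)) }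
  assoc X := TopCat.hom_ext <| ContinuousMap.ext fun 𝒞 => closeds_ext_of_hit fun U hU => by
    refine (hit_biUnion _ hU).trans ((hit_image _ _ (isOpen_hit hU)).trans ?_)
    refine Iff.trans ?_ ((hit_biUnion _ hU).trans (hit_biUnion _ (isOpen_hit hU))).symm
    exact iff_of_eq (congrArg (fun S => Set.Nonempty (_ ∩ S))
      (Set.ext fun C => hit_biUnion (show Closeds (Closeds X) from C : Set (Closeds X)) hU))
  left_unit X := TopCat.hom_ext <| ContinuousMap.ext fun C => closeds_ext_of_hit fun U hU =>
    (hit_biUnion _ hU).trans (hit_singleton C (isOpen_hit hU))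
  right_unit X := TopCat.hom_ext <| ContinuousMap.ext fun C => closeds_ext_of_hit fun U hU => by
    refine (hit_biUnion _ hU).trans ((hit_image _ _ (isOpen_hit hU)).trans ?_)
    exact iff_of_eq (congrArg (fun S => Set.Nonempty (_ ∩ S))
      (Set.ext fun x => hit_singleton x hU))

end LowerVietoris

/-! ### Complete join-semilattices and the dual adjunction `Top(-, 𝕊) ⊣ CJSL(-, 2)` -/

/-- The category of complete join-semilattices and maps preserving arbitrary joins. -/
structure CJSL where
  /-- The underlying set. -/
  carrier : Type u
  [str : CompleteSemilatticeSup carrier]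

attribute [instance] CJSL.str

instance : Category CJSL.{u} where
  Hom J K := sSupHom J.carrier K.carrier
  id J := sSupHom.id J.carrier
  comp f g := sSupHom.comp g f

/-- `CJSL(J, 2)` as a subspace of the power `𝕊 ^ J` of the Sierpinski space, where `2 = Prop` with
`False < True`. -/
instance sSupHomPropTopology (J : Type u) [SupSet J] : TopologicalSpace (sSupHom J Prop) :=
  .induced (fun h : sSupHom J Prop => (h : J → Prop)) inferInstance

/-- The functor `Top(-, 𝕊) : Top ⥤ CJSLᵒᵖ`: continuous maps `X → 𝕊` are identified with open subsets
of `X`, and a continuous map acts by preimage. -/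
def opensCJSL : TopCat.{u} ⥤ CJSL.{u}ᵒᵖ where
  obj X := op ⟨Opens X⟩
  map {X Y} f := Quiver.Hom.op (X := CJSL.mk (Opens Y)) (Y := CJSL.mk (Opens X))
    (Opens.comap f.hom : sSupHom (Opens Y) (Opens X))
  map_id _ := rfl
  map_comp _ _ := rfl

/-- The functor `CJSL(-, 2) : CJSLᵒᵖ ⥤ Top`, acting on morphisms by precomposition. -/
def dualCJSL : CJSL.{u}ᵒᵖ ⥤ TopCat.{u} where
  obj J := TopCat.of (sSupHom J.unop.carrier Prop)
  map {J K} f := TopCat.ofHom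
    { toFun := fun h => sSupHom.comp h f.unop
      continuous_toFun := continuous_induced_rng.2 <| continuous_pi fun k =>
        (continuous_apply (DFunLike.coe (F := sSupHom K.unop.carrier J.unop.carrier) f.unop k)).comp
          continuous_induced_dom }
  map_id J := rfl
  map_comp f g := rfl

/-- The map `X → CJSL(J, 2)` corresponding to a join-preserving map `h : J → Top(X, 𝕊)`, given by
`x ↦ (j ↦ x ∈ h j)`. -/
def toDualMap {X J : Type u} [TopologicalSpace X] [CompleteSemilatticeSup J]
    (h : sSupHom J (Opens X)) : C(X, sSupHom J Prop) where
  toFun x :=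
    { toFun := fun j => x ∈ h j
      map_sSup' := fun S => by
        rw [map_sSup]
        simp only [sSup_Prop_eq, Set.exists_mem_image, Opens.mem_sSup] }
  continuous_toFun := continuous_induced_rng.2 <| continuous_pi fun j =>
    continuous_Prop.2 (h j).isOpen

/-- The join-preserving map `J → Top(X, 𝕊)` corresponding to a continuous map `g : X → CJSL(J, 2)`,
given by `j ↦ {x | g x j}`. -/
def ofDualMap {X J : Type u} [TopologicalSpace X] [CompleteSemilatticeSup J]
    (g : C(X, sSupHom J Prop)) : sSupHom J (Opens X) where
  toFun j := ⟨{x | g x j},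
    continuous_Prop.1 ((continuous_apply j).comp (continuous_induced_dom.comp g.continuous))⟩
  map_sSup' S := by
    ext x
    simp [sSup_Prop_eq, map_sSup, -eq_iff_iff]

/-- The dual adjunction `Top(-, 𝕊) ⊣ CJSL(-, 2)`: join-preserving maps `h : J → Top(X, 𝕊)` and
continuous maps `g : X → CJSL(J, 2)` correspond via `x ∈ h j ↔ g x j`. -/
def opensDualAdjunction : opensCJSL.{u} ⊣ dualCJSL.{u} :=
  Adjunction.mkOfHomEquiv
    { homEquiv X J :=
        { toFun := fun h => TopCat.ofHom (Y := sSupHom J.unop.carrier Prop)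
            (toDualMap (J := J.unop.carrier) h.unop)
          invFun := fun g => Quiver.Hom.op (X := J.unop) (Y := CJSL.mk (Opens X))
            (ofDualMap (J := J.unop.carrier) (show C(X, sSupHom J.unop.carrier Prop) from g.hom))
          left_inv := fun _ => rfl
          right_inv := fun _ => rfl }
      homEquiv_naturality_left_symm := fun _ _ => rfl
      homEquiv_naturality_right := fun _ _ => rfl }

/-! A closed set `C` is determined by its trace on open sets, the predicate `U ↦ (C ∩ U).Nonempty`,
and this trace preserves arbitrary joins. Conversely, a join-preserving `p : Opens X → Prop` is the
trace of the complement of the largest open set on which `p` fails (`closedsOfTrace_hit`). The lower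
Vietoris topology makes exactly these predicates continuous, so `Closeds X` is homeomorphic to the
space of join-preserving maps to 2. This is the second claim at the level of spaces.

For the first claim, a cone over the arrows `X ⟶ 𝕊 ^ A` amounts to the same data. Kleisli
projections onto one coordinate reduce every leg to the legs at arrows `X ⟶ 𝕊`, that is, at open
sets (`coneLeg_iff`). Kleisli union maps force these to preserve joins (`coneTrace_sSup`). Each
point of the cone therefore yields a unique closed set.

Both monad structures are then compared by testing which open sets are hit. For the codensity monad
it suffices that the counit is a monad algebra on each `𝕊 ^ A`. -/

section Codensity

/-! ### Recognizing a codensity monad -/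

variable {A : Type w} {C : Type u} [Category.{v} C] [Category.{v'} A]

/-- A monad whose underlying functor is a right Kan extension of `F` along itself, compatibly with
the unit and the multiplication, is isomorphic to the codensity monad of `F`. -/
noncomputable def isoCodensityMonad (F : A ⥤ C) [F.HasRightKanExtension F] (M : Monad C)
    (φ : F ⋙ M.toFunctor ⟶ F) [M.toFunctor.IsRightKanExtension φ]
    (hη : ∀ X, M.η.app (F.obj X) ≫ φ.app X = 𝟙 (F.obj X))
    (hμ : ∀ X, M.μ.app (F.obj X) ≫ φ.app X = M.map (φ.app X) ≫ φ.app X) :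
    M ≅ codensityMonad F :=
  let T := F.rightKanExtension F
  let ψ : F ⋙ T ⟶ F := F.rightKanExtensionCounit F
  let e : M.toFunctor ≅ T := M.toFunctor.rightKanExtensionUnique φ T ψ
  have he (X : A) : e.hom.app (F.obj X) ≫ ψ.app X = φ.app X := by
    simp [e, Functor.rightKanExtensionUnique, Functor.rightKanExtensionUniqueOfIso]
  have hη' (X : A) : (codensityMonad F).η.app (F.obj X) ≫ ψ.app X = 𝟙 (F.obj X) := by
    simp [codensityMonad, T, ψ]
  have hμ' (X : A) : (codensityMonad F).μ.app (F.obj X) ≫ ψ.app X =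
      T.map (ψ.app X) ≫ ψ.app X := by
    simp [codensityMonad, T, ψ]
  MonadIso.mk e
    (fun X => by
      -- Transformations into `T` are equal once they agree after composition with the counit `ψ`.
      have h : M.η ≫ e.hom = (codensityMonad F).η := by
        apply T.hom_ext_of_isRightKanExtension ψ
        ext X
        refine (Category.assoc _ _ _).trans ?_
        refine (congrArg (M.η.app (F.obj X) ≫ ·) (he X)).trans ?_
        exact (hη X).trans (hη' X).symm
      exact NatTrans.congr_app h X)
    (fun X => by
      have h : M.μ ≫ e.hom =
          (e.hom ◫ e.hom : M.toFunctor ⋙ M.toFunctor ⟶ T ⋙ T) ≫ (codensityMonad F).μ := by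
        apply T.hom_ext_of_isRightKanExtension ψ
        ext X
        refine (Category.assoc _ _ _).trans ?_
        refine (congrArg (M.μ.app (F.obj X) ≫ ·) (he X)).trans ?_
        refine (hμ X).trans ?_
        refine Eq.trans ?_ (Category.assoc _ _ _).symm
        refine Eq.trans ?_ (congrArg ((e.hom ◫ e.hom).app (F.obj X) ≫ ·) (hμ' X)).symm
        rw [NatTrans.hcomp_app, Category.assoc, ← T.map_comp_assoc, he, ← e.hom.naturality_assoc,
          he]
      refine (NatTrans.congr_app h X).trans ?_
      refine congrArg (· ≫ (codensityMonad F).μ.app X) ?_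
      -- Naturality of `e` identifies the two ways of writing the horizontal composite of `e` with
      -- itself.
      exact (NatTrans.hcomp_app _ _ X).trans (e.hom.naturality (e.hom.app X)).symm)

end Codensity

/-! ### Closed sets as join-preserving predicates; the counit -/

section LowerVietoris

attribute [local instance] lowerVietorisTopology

/-- The closed set whose complement is the union of the open sets on which `p` is false. -/
def closedsOfTrace {X : Type u} [TopologicalSpace X] (p : Opens X → Prop) : Closeds X :=
  (sSup {U : Opens X | ¬ p U}).compl

/-- If `p U` held while the closed set missed `U`, then `U` would lie in the union of the open sets
where `p` fails. By monotonicity `p` would hold of that union, hence of one of its members. -/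
theorem closedsOfTrace_hit {X : Type u} [TopologicalSpace X] {p : Opens X → Prop}
    (hp : ∀ S : Set (Opens X), p (sSup S) ↔ ∃ U ∈ S, p U) (U : Opens X) :
    ((closedsOfTrace p : Set X) ∩ U).Nonempty ↔ p U := by
  have hmono {V W : Opens X} (h : V ≤ W) (hV : p V) : p W := by
    -- Monotonicity is join preservation for a pair whose join is `W`.
    have := (hp {V, W}).2 ⟨V, by simp, hV⟩
    rwa [sSup_pair, sup_eq_right.2 h] at this
  constructor
  · rintro ⟨x, hx, hxU⟩
    by_contra hU
    exact hx (Opens.mem_sSup.2 ⟨U, hU, hxU⟩)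
  · intro hU
    by_contra hne
    have hle : U ≤ sSup {U : Opens X | ¬ p U} := fun x hxU => by
      by_contra hx
      exact hne ⟨x, hx, hxU⟩
    obtain ⟨V, hV, hV'⟩ := (hp _).1 (hmono hle hU)
    exact hV hV'

theorem hit_sSup {X : Type u} [TopologicalSpace X] (C : Set X) (S : Set (Opens X)) :
    (C ∩ (sSup S : Opens X)).Nonempty ↔ ∃ U ∈ S, (C ∩ (U : Opens X)).Nonempty := by
  constructor
  · rintro ⟨x, hx, hxS⟩
    obtain ⟨U, hU, hxU⟩ := Opens.mem_sSup.1 hxS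
    exact ⟨U, hU, x, hx, hxU⟩
  · rintro ⟨U, hU, x, hx, hxU⟩
    exact ⟨x, hx, Opens.mem_sSup.2 ⟨U, hU, hxU⟩⟩

/-- The open subset of `𝕊 ^ A` of the subsets of `A` containing `a`. -/
def powerCoordinate {A : Type u} (a : A) : Opens (A → Prop) :=
  ⟨{χ | χ a}, continuous_Prop.1 (continuous_apply a)⟩

/-- The algebra structure `C ↦ ⋃ S ∈ C, S` of `𝕊 ^ A` for the lower Vietoris monad. -/
def hitCoordinates (A : Type u) : C(Closeds (A → Prop), A → Prop) where
  toFun C a := ((C : Set (A → Prop)) ∩ powerCoordinate a).Nonempty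
  continuous_toFun := continuous_pi fun a =>
    continuous_Prop.2 (isOpen_hit (powerCoordinate a).isOpen)

/-- The counit exhibiting the lower Vietoris functor as right Kan extension of `U_P` along itself.
-/
def lowerVietorisCounit :
    powersetKleisliToTop.{u} ⋙ lowerVietorisMonad.{u}.toFunctor ⟶ powersetKleisliToTop.{u} where
  app A := TopCat.ofHom (hitCoordinates A.of)
  naturality A B f := TopCat.hom_ext <| ContinuousMap.ext fun (C : Closeds (A.of → Prop)) =>
    funext fun b => propext <| by
      refine (hit_image _ _ (powerCoordinate b).isOpen).trans ?_
      constructor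
      · rintro ⟨S, hS, a, ha, hb⟩
        exact ⟨a, ⟨S, hS, ha⟩, hb⟩
      · rintro ⟨a, ⟨S, hS, ha⟩, hb⟩
        exact ⟨S, hS, a, ha, hb⟩

/-- Unit law of the algebra `𝕊 ^ A`; it makes the Vietoris unit satisfy the equation defining the
codensity unit. -/
theorem lowerVietoris_unit_counit (A : Kleisli powersetMonad.{u}) :
    lowerVietorisMonad.{u}.η.app (powersetKleisliToTop.obj A) ≫ lowerVietorisCounit.app A =
      𝟙 (powersetKleisliToTop.obj A) :=
  TopCat.hom_ext <| ContinuousMap.ext fun (S : A.of → Prop) => funext fun a => propext <|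
    hit_singleton S (powerCoordinate a).isOpen

/-- Associativity law of the same algebra: both sides say that some member of the family hits the
coordinate open set. -/
theorem lowerVietoris_mul_counit (A : Kleisli powersetMonad.{u}) :
    lowerVietorisMonad.{u}.μ.app (powersetKleisliToTop.obj A) ≫ lowerVietorisCounit.app A =
      lowerVietorisMonad.{u}.map (lowerVietorisCounit.app A) ≫ lowerVietorisCounit.app A :=
  TopCat.hom_ext <| ContinuousMap.ext fun (_ : Closeds (Closeds (A.of → Prop))) =>
    funext fun a => propext <|
      (hit_biUnion _ (powerCoordinate a).isOpen).trans
        (hit_image (hitCoordinates A.of) _ (powerCoordinate a).isOpen).symm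

/-! ### Cones over `X ⟶ 𝕊 ^ A` and the limit property -/

section Cones

variable {X : TopCat.{u}}

/-- The object of the comma category of `X` and `U_P` given by a family of open subsets of `X`. -/
def opensArrow {ι : Type u} (W : ι → Opens X) : StructuredArrow X powersetKleisliToTop.{u} :=
  StructuredArrow.mk (Y := Kleisli.mk powersetMonad.{u} ι)
    (TopCat.ofHom (X := X) (Y := ι → Prop)
      ⟨fun x i => x ∈ W i, continuous_pi fun i => continuous_Prop.2 (W i).isOpen⟩)

/-- The open subset of `X` on which the coordinate `a` of `f : X ⟶ 𝕊 ^ A` holds. -/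
def arrowOpens (f : StructuredArrow X powersetKleisliToTop.{u}) (a : f.right.of) : Opens X :=
  (powerCoordinate a).comap (show C(X, f.right.of → Prop) from f.hom.hom)

/-- The projection of `f` to its coordinate `a`. -/
def arrowProjection (f : StructuredArrow X powersetKleisliToTop.{u}) (a : f.right.of) :
    f ⟶ opensArrow fun _ : PUnit.{u + 1} => arrowOpens f a :=
  StructuredArrow.homMk
    (Kleisli.Hom.mk (↾(fun a' : f.right.of => ({_u : PUnit.{u + 1} | a' = a} : Set PUnit))))
    (TopCat.hom_ext <| ContinuousMap.ext fun _ => funext fun _ => propext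
      ⟨fun ⟨_, hx, h⟩ => (show _ = a from h) ▸ hx, fun hx => ⟨a, hx, rfl⟩⟩)

/-- The map from a family of open subsets to its union. -/
def arrowUnion (S : Set (Opens X)) :
    (opensArrow fun U : S => (U : Opens X)) ⟶ opensArrow fun _ : PUnit.{u + 1} => sSup S :=
  StructuredArrow.homMk
    (Kleisli.Hom.mk (↾(fun _ : S => (Set.univ : Set PUnit.{u + 1}))))
    (TopCat.hom_ext <| ContinuousMap.ext fun _ => funext fun _ => propext
      ⟨fun ⟨(U : S), hx, _⟩ => Opens.mem_sSup.2 ⟨U.1, U.2, hx⟩, fun hx =>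
        let ⟨U, hU, hxU⟩ := Opens.mem_sSup.1 hx
        ⟨⟨U, hU⟩, hxU, trivial⟩⟩)

variable (s : Limits.Cone (StructuredArrow.proj X powersetKleisliToTop.{u} ⋙
  powersetKleisliToTop.{u}))

/-- The leg of a cone at `f : X ⟶ 𝕊 ^ A`. -/
def coneLeg (f : StructuredArrow X powersetKleisliToTop.{u}) : C(s.pt, f.right.of → Prop) :=
  (s.π.app f).hom

/-- The open sets which a point of a cone hits, as seen by the legs at the arrows `X ⟶ 𝕊`. -/
def coneTrace (z : s.pt) (U : Opens X) : Prop :=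
  coneLeg s (opensArrow fun _ : PUnit.{u + 1} => U) z PUnit.unit

theorem coneLeg_naturality {f g : StructuredArrow X powersetKleisliToTop.{u}} (h : f ⟶ g)
    (z : s.pt) : (powersetKleisliToTop.map h.right).hom (coneLeg s f z) = coneLeg s g z :=
  ConcreteCategory.congr_hom (s.w h) z

/-- Naturality along the Kleisli morphism `A → 1` that sends `a` to the point and every other
element to `∅`. -/
theorem coneLeg_iff (f : StructuredArrow X powersetKleisliToTop.{u}) (z : s.pt) (a : f.right.of) :
    coneLeg s f z a ↔ coneTrace s z (arrowOpens f a) := by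
  rw [coneTrace, ← coneLeg_naturality s (arrowProjection f a) z]
  exact ⟨fun h => ⟨a, h, rfl⟩, fun ⟨_, h, h'⟩ => (show _ = a from h') ▸ h⟩

/-- Naturality along the Kleisli morphism `S → 1` with constant value the full set, which acts as
the union `𝕊 ^ S → 𝕊`. -/
theorem coneTrace_sSup (z : s.pt) (S : Set (Opens X)) :
    coneTrace s z (sSup S) ↔ ∃ U ∈ S, coneTrace s z U := by
  rw [coneTrace, ← coneLeg_naturality s (arrowUnion S) z]
  constructor
  · rintro ⟨(U : S), h, -⟩
    exact ⟨U.1, U.2, (coneLeg_iff s (opensArrow fun U : S => (U : Opens X)) z U).1 h⟩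
  · rintro ⟨U, hU, h⟩
    exact ⟨⟨U, hU⟩, (coneLeg_iff s (opensArrow fun U : S => (U : Opens X)) z ⟨U, hU⟩).2 h, trivial⟩

theorem isOpen_coneTrace (U : Opens X) : IsOpen {z | coneTrace s z U} :=
  continuous_Prop.1 ((continuous_apply PUnit.unit).comp (coneLeg s _).continuous)

/-- The map to the lower Vietoris space induced by a cone. -/
def coneLift : C(s.pt, Closeds X) where
  toFun z := closedsOfTrace (coneTrace s z)
  continuous_toFun := continuous_of_hit fun U hU => by
    have h (z : s.pt) : ((closedsOfTrace (coneTrace s z) : Set X) ∩ U).Nonempty ↔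
      coneTrace s z ⟨U, hU⟩ := closedsOfTrace_hit (coneTrace_sSup s z) ⟨U, hU⟩
    simp only [h]
    exact isOpen_coneTrace s _

end Cones

/-- The lower Vietoris functor is a pointwise right Kan extension of `U_P` along itself. -/
def lowerVietorisIsPointwiseRightKanExtension :
    (Functor.RightExtension.mk lowerVietorisMonad.{u}.toFunctor
      lowerVietorisCounit.{u}).IsPointwiseRightKanExtension := fun X =>
  { lift := fun s => TopCat.ofHom (coneLift s)
    fac := fun s f => TopCat.hom_ext <| ContinuousMap.ext fun z => funext fun a => propext <|
      (hit_image f.hom _ (powerCoordinate a).isOpen).trans <|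
        (closedsOfTrace_hit (coneTrace_sSup s z) (arrowOpens f a)).trans (coneLeg_iff s f z a).symm
    uniq := fun s m hm => TopCat.hom_ext <| ContinuousMap.ext fun z =>
      closeds_ext_of_hit fun U hU => by
        refine Iff.trans ?_ (closedsOfTrace_hit (coneTrace_sSup s z) ⟨U, hU⟩).symm
        -- The leg at `U`, viewed as an arrow `X ⟶ 𝕊`, already decides whether `m z` hits `U`.
        refine Iff.trans ?_ (iff_of_eq (congrFun (ConcreteCategory.congr_hom
          (hm (opensArrow fun _ : PUnit.{u + 1} => ⟨U, hU⟩)) z) PUnit.unit))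
        exact (hit_image (opensArrow fun _ : PUnit.{u + 1} => (⟨U, hU⟩ : Opens X)).hom _
          (powerCoordinate PUnit.unit).isOpen).symm }

/-! ### The monad of the dual adjunction -/

/-- The join-preserving map `U ↦ (C ∩ U ≠ ∅)` determined by a closed set `C`. -/
def hitHom {X : Type u} [TopologicalSpace X] (C : Closeds X) : sSupHom (Opens X) Prop where
  toFun U := ((C : Set X) ∩ U).Nonempty
  map_sSup' S := by
    rw [sSup_Prop_eq]
    simp only [Set.exists_mem_image]
    exact propext (hit_sSup (C : Set X) S)

/-- Closed subsets of `X` correspond to join-preserving maps from the open sets to `2`. -/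
def closedsHomeomorph (X : Type u) [TopologicalSpace X] :
    Closeds X ≃ₜ sSupHom (Opens X) Prop where
  toFun := hitHom
  invFun h := closedsOfTrace h
  left_inv C := closeds_ext_of_hit fun U hU =>
    closedsOfTrace_hit (p := hitHom C) (hit_sSup (C : Set X)) ⟨U, hU⟩
  right_inv h := DFunLike.ext _ _ fun U => propext <| closedsOfTrace_hit
    (fun S => by rw [map_sSup, sSup_Prop_eq, Set.exists_mem_image]) U
  continuous_toFun := continuous_induced_rng.2 <| continuous_pi fun U =>
    continuous_Prop.2 (isOpen_hit U.isOpen)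
  continuous_invFun := continuous_of_hit fun U hU => by
    have h (g : sSupHom (Opens X) Prop) :
        ((closedsOfTrace g : Set X) ∩ U).Nonempty ↔ g ⟨U, hU⟩ :=
      closedsOfTrace_hit (fun S => by rw [map_sSup, sSup_Prop_eq, Set.exists_mem_image]) ⟨U, hU⟩
    simp only [h]
    exact continuous_Prop.1 ((continuous_apply (⟨U, hU⟩ : Opens X)).comp continuous_induced_dom)

/-- The lower Vietoris monad is the monad of the dual adjunction `Top(-, 𝕊) ⊣ CJSL(-, 2)`. -/
def lowerVietorisIsoDual : lowerVietorisMonad.{u} ≅ opensDualAdjunction.{u}.toMonad :=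
  MonadIso.mk
    (NatIso.ofComponents (F := lowerVietorisMonad.{u}.toFunctor)
      (G := opensDualAdjunction.{u}.toMonad.toFunctor)
      (fun X => TopCat.isoOfHomeo (X := TopCat.of (Closeds X))
        (Y := TopCat.of (sSupHom (Opens X) Prop)) (closedsHomeomorph X))
      (fun {X Y} f => TopCat.hom_ext <| ContinuousMap.ext fun (_ : Closeds X) =>
        DFunLike.ext (F := sSupHom (Opens Y) Prop) _ _ fun U => propext <|
          hit_image f _ U.isOpen))
    (fun X => TopCat.hom_ext <| ContinuousMap.ext fun x =>
      DFunLike.ext (F := sSupHom (Opens X) Prop) _ _ fun U => propext <|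
        hit_singleton x U.isOpen)
    (fun X => TopCat.hom_ext <| ContinuousMap.ext fun (𝒞 : Closeds (Closeds X)) =>
      DFunLike.ext (F := sSupHom (Opens X) Prop) _ _ fun U => propext <|
        (hit_biUnion _ U.isOpen).trans
          -- The multiplication of the dual monad evaluates at the open set `{h | h U}`, whose
          -- preimage under the homeomorphism is `◇U`.
          (hit_image (closedsHomeomorph X) (𝒞 : Set (Closeds X))
            (U := {h : sSupHom (Opens X) Prop | h U})
            (continuous_Prop.1 ((continuous_apply U).comp continuous_induced_dom))).symm)

end LowerVietoris

theorem mainTheorem5 :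
    (∃ _ : powersetKleisliToTop.{u}.HasPointwiseRightKanExtension powersetKleisliToTop.{u},
      Nonempty (lowerVietorisMonad.{u} ≅ codensityMonad powersetKleisliToTop.{u})) ∧
    (∃ e : lowerVietorisMonad.{u} ≅ opensDualAdjunction.{u}.toMonad,
      ∀ (X : TopCat.{u}) (C : Closeds X) (U : Opens X),
        DFunLike.coe (F := sSupHom (Opens X) Prop) (e.hom.app X C) U ↔
          ((C : Set X) ∩ U).Nonempty) := by
  have hp := lowerVietorisIsPointwiseRightKanExtension.{u}
  have : powersetKleisliToTop.{u}.HasPointwiseRightKanExtension powersetKleisliToTop.{u} :=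
    hp.hasPointwiseRightKanExtension
  have : lowerVietorisMonad.{u}.toFunctor.IsRightKanExtension lowerVietorisCounit.{u} :=
    hp.isRightKanExtension
  exact ⟨⟨inferInstance, ⟨isoCodensityMonad _ _ lowerVietorisCounit
    lowerVietoris_unit_counit lowerVietoris_mul_counit⟩⟩,
    lowerVietorisIsoDual, fun _ _ _ => Iff.rfl⟩
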